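/- A quandle is a set $Q$ with operations $*,\backslash$ satisfying $x*(x\backslash y)=y=x\backslash(x*y)$, $x*(y*z)=(x*y)*(x*z)$ and $x*x=x$; write $L_x(y)=x*y$ and $\mathrm{LMlt}(Q)=\langle L_x : x\in Q\rangle$. A projection quandle is one with $x*y=y$ for all $x,y$. Let $\pi_0$ be the left adjoint of the inclusion of the category of projection quandles into the category of quandles; $\pi_0(Q)$ is the set of $\mathrm{LMlt}(Q)$-orbits of $Q$ with the projection operation, and the unit $\eta_Q:Q\to\pi_0(Q)$ is the canonical map. A surjective homomorphism of quandles $f:A\to B$ is a trivial extension if the square $\pi_0(f)\circ\eta_A=\eta_B\circ f$ is a pullback, and a normal extension if the first projection $A\times_B A\to A$ of its kernel pair is a trivial extension. A congruence $\alpha$ of $Q$ (an equivalence relation invariant under $*$ and $\backslash$) is strongly abelian if for every term $t(x,y_1,\dots,y_n)$ in the operations $*,\backslash$, all $u\,\alpha\,v$ and all $a_i\,\alpha\,b_i\,\alpha\,c_i$, $$t(u,a_1,\dots,a_n)=t(v,b_1,\dots,b_n)\ \Longrightarrow\ t(u,c_1,\dots,c_n)=t(v,c_1,\dots,c_n).$$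 It is central (in the sense of commutator theory, $[\alpha,1_Q]=0_Q$) if for every term $t(x,y_1,\dots,y_n)$, all $a\,\alpha\,b$ and all $u_i,v_i\in Q$, $$t(a,u_1,\dots,u_n)=t(a,v_1,\dots,v_n)\ \Longrightarrow\ t(b,u_1,\dots,u_n)=t(b,v_1,\dots,v_n).$$ **Theorem.** (1) Let $Q$ be a quandle and $\alpha$ a congruence of $Q$. The natural projection $Q\to Q/\alpha$ is a normal extension if and only if $\alpha$ is strongly abelian and central. (2) Consequently, normal extensions coincide with central coverings: a homomorphism of quandles $f:Q\to R$ is a normal extension if and only if it is a central covering, that is, $f$ is surjective, $f(x)=f(y)$ implies $L_x=L_y$, and the kernel congruence of $f$ is central. -/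

import Mathlib

open CategoryTheory
open scoped Quandles

universe u v₁ v₂ u₁ u₂

/-! ### The algebraic signature of racks and terms in it -/

/-- The two operation symbols of left quasigroups: `*` (Mathlib's `◃`) and `\` (Mathlib's `◃⁻¹`),
both binary. -/
inductive LeftQuasigroupFunc : ℕ → Type
  | act : LeftQuasigroupFunc 2
  | invAct : LeftQuasigroupFunc 2

/-- The first-order language of left quasigroups: two binary operations `*` and `\`. -/
def leftQuasigroupLang : FirstOrder.Language :=
  ⟨LeftQuasigroupFunc, fun _ => Empty⟩

/-- A rack interprets `x * y` as `x ◃ y` and `x \ y` as `x ◃⁻¹ y`. -/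
instance rackStructure (Q : Type u) [Rack Q] : leftQuasigroupLang.Structure Q where
  funMap := fun {_} f x =>
    match f, x with
    | LeftQuasigroupFunc.act, x => x 0 ◃ x 1
    | LeftQuasigroupFunc.invAct, x => x 0 ◃⁻¹ x 1
  RelMap := fun r _ => r.elim

/-! ### Congruences -/

/-- A congruence of a rack: an equivalence relation invariant under both operations. -/
structure RackCongruence (Q : Type u) [Rack Q] extends Setoid Q where
  act_congr : ∀ {a b c d : Q}, toSetoid a b → toSetoid c d → toSetoid (a ◃ c) (b ◃ d)
  invAct_congr : ∀ {a b c d : Q}, toSetoid a b → toSetoid c d → toSetoid (a ◃⁻¹ c) (b ◃⁻¹ d)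

namespace RackCongruence

/-- The smallest congruence `0_Q`, equality. -/
def zero (Q : Type u) [Rack Q] : RackCongruence Q where
  toSetoid := ⊥
  act_congr := by
    intro a b c d h k
    have h' : a = b := h
    have k' : c = d := k
    subst h' k'
    exact (⊥ : Setoid Q).refl _
  invAct_congr := by
    intro a b c d h k
    have h' : a = b := h
    have k' : c = d := k
    subst h' k'
    exact (⊥ : Setoid Q).refl _

/-- The largest congruence `1_Q`, all pairs. -/
def one (Q : Type u) [Rack Q] : RackCongruence Q where
  toSetoid := ⊤
  act_congr := fun _ _ => trivial
  invAct_congr := fun _ _ => trivial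

/-- The kernel of a homomorphism of racks. -/
def ker {Q R : Type u} [Rack Q] [Rack R] (f : Q →◃ R) : RackCongruence Q where
  toSetoid := Setoid.ker f
  act_congr := by
    intro a b c d h k
    have h' : f a = f b := h
    have k' : f c = f d := k
    change f (a ◃ c) = f (b ◃ d)
    rw [f.map_act, f.map_act, h', k']
  invAct_congr := by
    intro a b c d h k
    have h' : f a = f b := h
    have k' : f c = f d := k
    change f (a ◃⁻¹ c) = f (b ◃⁻¹ d)
    rw [← Rack.left_cancel (f a), ← f.map_act, Rack.act_invAct_eq, h', ← f.map_act,
      Rack.act_invAct_eq, k']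

/-- `α` is strongly abelian over `β`: for every term `t(x, y₁, …, yₙ)`, all `u α v` and
`aᵢ α bᵢ α cᵢ`, if `t(u, a) β t(v, b)` then `t(u, c) β t(v, c)`. -/
def StronglyAbelianOver {Q : Type u} [Rack Q] (α β : RackCongruence Q) : Prop :=
  ∀ (n : ℕ) (t : leftQuasigroupLang.Term (Fin (n + 1))) (u v : Q) (a b c : Fin n → Q),
    α.toSetoid u v → (∀ i, α.toSetoid (a i) (b i)) → (∀ i, α.toSetoid (b i) (c i)) →
    β.toSetoid (t.realize (Fin.cons u a : Fin (n + 1) → Q))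
      (t.realize (Fin.cons v b : Fin (n + 1) → Q)) →
    β.toSetoid (t.realize (Fin.cons u c : Fin (n + 1) → Q))
      (t.realize (Fin.cons v c : Fin (n + 1) → Q))

/-- A congruence is strongly abelian if it is strongly abelian over `0_Q`. -/
def IsStronglyAbelian {Q : Type u} [Rack Q] (α : RackCongruence Q) : Prop :=
  α.StronglyAbelianOver (zero Q)

/-- The centralizing relation `C(α, β; δ)` of commutator theory: for every term
`t(x, y₁, …, yₙ)`, all `a α b` and `uᵢ β vᵢ`, if `t(a, u) δ t(a, v)` then `t(b, u) δ t(b, v)`. -/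
def Centralizes {Q : Type u} [Rack Q] (α β δ : RackCongruence Q) : Prop :=
  ∀ (n : ℕ) (t : leftQuasigroupLang.Term (Fin (n + 1))) (a b : Q) (u v : Fin n → Q),
    α.toSetoid a b → (∀ i, β.toSetoid (u i) (v i)) →
    δ.toSetoid (t.realize (Fin.cons a u : Fin (n + 1) → Q))
      (t.realize (Fin.cons a v : Fin (n + 1) → Q)) →
    δ.toSetoid (t.realize (Fin.cons b u : Fin (n + 1) → Q))
      (t.realize (Fin.cons b v : Fin (n + 1) → Q))

/-- A congruence `α` is central, in the sense of commutator theory, if `C(α, 1_Q; 0_Q)`,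
that is, if the commutator `[α, 1_Q]` is `0_Q`. -/
def IsCentral {Q : Type u} [Rack Q] (α : RackCongruence Q) : Prop :=
  α.Centralizes (one Q) (zero Q)

/-- The underlying set of the factor `Q/α`. -/
def Factor {Q : Type u} [Rack Q] (α : RackCongruence Q) : Type u :=
  Quotient α.toSetoid

/-- The factor `Q/α` of a quandle by a congruence, with the operations induced from `Q`. -/
instance factorQuandle {Q : Type u} [Quandle Q] (α : RackCongruence Q) : Quandle α.Factor where
  act := Quotient.map₂ (fun x y => x ◃ y) (fun _ _ h _ _ k => α.act_congr h k)
  invAct := Quotient.map₂ (fun x y => x ◃⁻¹ y) (fun _ _ h _ _ k => α.invAct_congr h k)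
  self_distrib := by
    rintro ⟨x⟩ ⟨y⟩ ⟨z⟩
    exact congrArg (Quotient.mk α.toSetoid) Shelf.self_distrib
  left_inv := by
    rintro ⟨x⟩ ⟨y⟩
    exact congrArg (Quotient.mk α.toSetoid) (Rack.left_inv x y)
  right_inv := by
    rintro ⟨x⟩ ⟨y⟩
    exact congrArg (Quotient.mk α.toSetoid) (Rack.right_inv x y)
  fix := by
    rintro ⟨x⟩
    exact congrArg (Quotient.mk α.toSetoid) Quandle.fix

/-- The natural projection `Q → Q/α`. -/
def proj {Q : Type u} [Quandle Q] (α : RackCongruence Q) : Q →◃ α.Factor where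
  toFun := Quotient.mk α.toSetoid
  map_act' := rfl

end RackCongruence

/-- A covering homomorphism: a surjective homomorphism `f` whose kernel is contained in the
Cayley kernel, i.e. `f x = f y` implies that the left translations by `x` and `y` agree. -/
def IsCovering {Q R : Type u} [Rack Q] [Rack R] (f : Q →◃ R) : Prop :=
  Function.Surjective f ∧ ∀ x y : Q, f x = f y → Rack.act' x = Rack.act' y

/-- A central covering: a covering homomorphism whose kernel is a central congruence. -/
def IsCentralCovering {Q R : Type u} [Rack Q] [Rack R] (f : Q →◃ R) : Prop :=
  IsCovering f ∧ (RackCongruence.ker f).IsCentral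

/-! ### The category of quandles and the reflection onto projection quandles -/

/-- The category of quandles (objects). -/
structure QuandleCat : Type (u + 1) where
  carrier : Type u
  [str : Quandle carrier]

instance : CoeSort QuandleCat.{u} (Type u) := ⟨QuandleCat.carrier⟩

instance (Q : QuandleCat.{u}) : Quandle Q := Q.str

/-- Morphisms of quandles are the homomorphisms. -/
instance : Category.{u} QuandleCat.{u} where
  Hom Q R := (Q : Type u) →◃ (R : Type u)
  id Q := ShelfHom.id Q
  comp f g := ShelfHom.comp g f

/-- A quandle homomorphism as a morphism of the category of quandles. -/
def QuandleCat.ofHom {Q R : Type u} [Quandle Q] [Quandle R] (f : Q →◃ R) :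
    QuandleCat.mk Q ⟶ QuandleCat.mk R := f

/-- The class of surjective homomorphisms of quandles. -/
def QuandleCat.surjective : MorphismProperty QuandleCat.{u} :=
  fun Q R f => Function.Surjective (ShelfHom.toFun (S₁ := Q) (S₂ := R) f)

/-- Projection quandles: those satisfying `x * y = y`. -/
def IsProjectionQuandle : ObjectProperty QuandleCat.{u} :=
  fun Q => ∀ x y : Q, x ◃ y = y

/-- The category of projection quandles, a full subcategory of the category of quandles. -/
abbrev ProjectionQuandleCat : Type (u + 1) := IsProjectionQuandle.{u}.FullSubcategory

/-- The multiplication group `LMlt(Q)`, generated by all left translations. -/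
def LMlt (Q : Type u) [Rack Q] : Subgroup (Equiv.Perm Q) :=
  Subgroup.closure (Set.range (Rack.act' (R := Q)))

/-- The set of connected components of `Q`: the orbits of `LMlt(Q)` on `Q`. -/
def ConnComp (Q : Type u) [Rack Q] : Type u := MulAction.orbitRel.Quotient (LMlt Q) Q

/-- The connected component of an element. -/
def ConnComp.mk {Q : Type u} [Rack Q] (x : Q) : ConnComp Q :=
  Quotient.mk (MulAction.orbitRel (LMlt Q) Q) x

/-- The set of connected components, as a projection quandle. -/
instance connCompQuandle (Q : Type u) [Rack Q] : Quandle (ConnComp Q) where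
  act _ y := y
  self_distrib := rfl
  invAct _ y := y
  left_inv _ _ := rfl
  right_inv _ _ := rfl
  fix := rfl

theorem ConnComp.mk_act {Q : Type u} [Rack Q] (x y : Q) :
    ConnComp.mk (x ◃ y) = ConnComp.mk y :=
  Quotient.sound ⟨⟨Rack.act' x, Subgroup.subset_closure ⟨x, rfl⟩⟩, rfl⟩

/-- A map that is invariant under all left translations is constant on the orbits. -/
theorem ConnComp.invariant {Q : Type u} [Rack Q] {S : Type u} (f : Q → S)
    (hf : ∀ x y : Q, f (x ◃ y) = f y) (g : Equiv.Perm Q) (hg : g ∈ LMlt Q) :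
    ∀ y, f (g y) = f y := by
  induction hg using Subgroup.closure_induction with
  | mem g hg => obtain ⟨x, rfl⟩ := hg; exact hf x
  | one => intro y; rfl
  | mul g h _ _ ihg ihh => intro y; exact (ihg (h y)).trans (ihh y)
  | inv g _ ih => intro y; simpa using (ih (g⁻¹ y)).symm

/-- The map on components induced by a map invariant under all left translations. -/
def ConnComp.lift {Q : Type u} [Rack Q] {S : Type u} (f : Q → S)
    (hf : ∀ x y : Q, f (x ◃ y) = f y) : ConnComp Q → S :=
  Quotient.lift f (by
    rintro a b ⟨g, rfl⟩
    exact ConnComp.invariant f hf g g.2 b)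

/-- The projection quandle of connected components of a quandle. -/
def connCompObj (Q : QuandleCat.{u}) : ProjectionQuandleCat.{u} :=
  ⟨⟨ConnComp Q⟩, fun _ _ => rfl⟩

/-- The canonical homomorphism from a quandle onto its components. -/
def connCompUnit (Q : QuandleCat.{u}) : Q ⟶ (connCompObj Q).obj :=
  { toFun := ConnComp.mk, map_act' := ConnComp.mk_act _ _ : (Q : Type u) →◃ ConnComp Q }

/-- The universal property of the components: homomorphisms from the components of `Q` to a
projection quandle `P` correspond to homomorphisms from `Q` to `P`. -/
def connCompEquiv (Q : QuandleCat.{u}) (P : ProjectionQuandleCat.{u}) :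
    (connCompObj Q ⟶ P) ≃ (Q ⟶ IsProjectionQuandle.{u}.ι.obj P) where
  toFun f := connCompUnit Q ≫ f.hom
  invFun f := ObjectProperty.homMk
    { toFun := ConnComp.lift (ShelfHom.toFun (S₁ := Q) (S₂ := P.obj) f)
        (fun x y => (ShelfHom.map_act' (S₁ := Q) (S₂ := P.obj) f).trans (P.property _ _))
      map_act' := (P.property _ _).symm : ConnComp Q →◃ (P.obj : Type u) }
  left_inv f := by
    ext1
    refine ShelfHom.ext (funext ?_)
    rintro ⟨x⟩
    rfl
  right_inv f := rfl

/-- The reflector `π₀` from quandles to projection quandles. -/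
def connCompFunctor : QuandleCat.{u} ⥤ ProjectionQuandleCat.{u} :=
  Adjunction.leftAdjointOfEquiv connCompEquiv (fun _ _ _ _ _ => rfl)

/-- The adjunction between quandles and projection quandles: `π₀` is left adjoint to the
inclusion. -/
def connCompAdjunction : connCompFunctor.{u} ⊣ IsProjectionQuandle.{u}.ι :=
  Adjunction.adjunctionOfEquivLeft connCompEquiv (fun _ _ _ _ _ => rfl)

/-! ### Normal extensions in categorical Galois theory -/

section Galois

variable {C : Type u₁} [Category.{v₁} C] {X : Type u₂} [Category.{v₂} X]

/-- Let `F ⊣ G` be an adjunction and `E` a class of morphisms (the extensions). A morphism `f` in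
`E` is a trivial extension if the naturality square of the unit at `f` is a pullback. -/
def IsTrivialExtension {F : C ⥤ X} {G : X ⥤ C} (adj : F ⊣ G) (E : MorphismProperty C)
    {A B : C} (f : A ⟶ B) : Prop :=
  E f ∧ IsPullback (adj.unit.app A) f (G.map (F.map f)) (adj.unit.app B)

/-- A morphism `f : A ⟶ B` in `E` is a normal extension if its pullback along itself, that is,
the first projection of its kernel pair `A ×_B A`, is a trivial extension. -/
def IsNormalExtension {F : C ⥤ X} {G : X ⥤ C} (adj : F ⊣ G) (E : MorphismProperty C)
    {A B : C} (f : A ⟶ B) : Prop :=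
  E f ∧ ∃ (K : C) (p₁ p₂ : K ⟶ A), IsKernelPair f p₁ p₂ ∧ IsTrivialExtension adj E p₁

end Galois

/-!
A surjection `f : A → B` of quandles is a trivial extension exactly when it is injective on each
`LMlt(A)`-orbit (`isTrivialExtension_iff`): the comparison map `A → π₀(A) ×_{π₀(B)} B` is always
onto, since left multiplications lift along surjections. Hence `f` is a normal extension exactly
when the first projection of the kernel pair of `f`, regarded as a subquandle of `Q × Q`, is
injective on connected components (`isNormalExtension_iff`).

For a congruence `α` the latter condition splits into two (`RackCongruence.isNormal_iff`):
congruent elements have equal left translations (`LeCayleyKernel`), and a left multiplication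
that fixes an element fixes its whole class (`FixesClasses`). Given the first condition, the
second is equivalent to centrality. In one direction, every term is a left multiplication applied
to its rightmost variable, and the left multiplication is unchanged when the arguments move within
their classes (`LeCayleyKernel.exists_realize_eq`). In the other, a left multiplication is the
value of a term whose parameters may be replaced by the argument itself, where idempotence makes
the term trivial (`IsCentral.fixesClasses`).

The first condition alone is equivalent to strong abelianness (`isStronglyAbelian_iff`): it implies
strong abelianness by the same normal form of terms, and strong abelianness for the single term
`x * y` already makes the left translations of congruent elements equal.
-/

/-! ### Connected components and multiplication groups -/

theorem ConnComp.mk_eq_mk_iff {Q : Type u} [Rack Q] {x y : Q} :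
    ConnComp.mk x = ConnComp.mk y ↔ ∃ g ∈ LMlt Q, g y = x := by
  constructor
  · intro h
    obtain ⟨g, hg⟩ := Quotient.exact h
    exact ⟨g, g.2, hg⟩
  · rintro ⟨g, hg, h⟩
    exact Quotient.sound ⟨⟨g, hg⟩, h⟩

theorem ConnComp.mk_invAct {Q : Type u} [Rack Q] (x y : Q) :
    ConnComp.mk (x ◃⁻¹ y) = ConnComp.mk y := by
  rw [← ConnComp.mk_act x (x ◃⁻¹ y), Rack.act_invAct_eq]

theorem Rack.act'_mem_LMlt {Q : Type u} [Rack Q] (x : Q) : Rack.act' x ∈ LMlt Q :=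
  Subgroup.subset_closure ⟨x, rfl⟩

theorem ShelfHom.map_invAct {Q R : Type*} [Rack Q] [Rack R] (f : Q →◃ R) (x y : Q) :
    f (x ◃⁻¹ y) = f x ◃⁻¹ f y := by
  rw [← Rack.left_cancel (f x), ← f.map_act, Rack.act_invAct_eq, Rack.act_invAct_eq]

theorem ConnComp.mk_map_eq {Q R : Type u} [Rack Q] [Rack R] (f : Q →◃ R) {x y : Q}
    (h : ConnComp.mk x = ConnComp.mk y) : ConnComp.mk (f x) = ConnComp.mk (f y) := by
  obtain ⟨g, hg, rfl⟩ := ConnComp.mk_eq_mk_iff.1 h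
  refine ConnComp.invariant (fun z => ConnComp.mk (f z)) (fun a b => ?_) g hg y
  rw [f.map_act, ConnComp.mk_act]

/-- Along a surjection, every left multiplication of the target lifts to the source. -/
theorem LMlt.exists_lift {Q R : Type u} [Rack Q] [Rack R] (f : Q →◃ R)
    (hf : Function.Surjective f) {g : Equiv.Perm R} (hg : g ∈ LMlt R) :
    ∃ h ∈ LMlt Q, ∀ x, f (h x) = g (f x) := by
  induction hg using Subgroup.closure_induction with
  | mem g hg =>
    obtain ⟨r, rfl⟩ := hg
    obtain ⟨q, rfl⟩ := hf r
    exact ⟨Rack.act' q, Rack.act'_mem_LMlt q, fun x => f.map_act⟩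
  | one => exact ⟨1, one_mem _, fun _ => rfl⟩
  | mul g₁ g₂ _ _ ih₁ ih₂ =>
    obtain ⟨h₁, m₁, e₁⟩ := ih₁
    obtain ⟨h₂, m₂, e₂⟩ := ih₂
    exact ⟨h₁ * h₂, mul_mem m₁ m₂, fun x => by simp [e₁, e₂]⟩
  | inv g _ ih =>
    obtain ⟨h, m, e⟩ := ih
    refine ⟨h⁻¹, inv_mem m, fun x => ?_⟩
    rw [Equiv.Perm.eq_inv_iff_eq, ← e, ← Equiv.Perm.mul_apply, mul_inv_cancel, Equiv.Perm.one_apply]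

/-! ### Pullbacks of quandles -/

namespace QuandleCat

/-- The homomorphism of quandles underlying a morphism of `QuandleCat`. -/
abbrev toShelfHom {A B : QuandleCat.{u}} (f : A ⟶ B) : (A : Type u) →◃ (B : Type u) := f

theorem hom_ext {A B : QuandleCat.{u}} {f g : A ⟶ B}
    (h : ∀ a, toShelfHom f a = toShelfHom g a) : f = g :=
  ShelfHom.ext (funext h)

/-- The one-point quandle. It is free on one generator, because quandles are idempotent, and so
represents the underlying set functor. -/
def point : QuandleCat.{u} where
  carrier := PUnit
  str :=
    { act _ y := y
      self_distrib := rfl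
      invAct _ y := y
      left_inv _ _ := rfl
      right_inv _ _ := rfl
      fix := rfl }

/-- The morphism from the one-point quandle that picks the element `a`. -/
def ofElement {A : QuandleCat.{u}} (a : A) : point.{u} ⟶ A :=
  { toFun := fun _ => a, map_act' := Quandle.fix.symm : PUnit →◃ (A : Type u) }

/-- Pullbacks of quandles are computed on underlying sets. -/
theorem isPullback_iff {P A B C : QuandleCat.{u}} {fst : P ⟶ A} {snd : P ⟶ B} {f : A ⟶ C}
    {g : B ⟶ C} :
    IsPullback fst snd f g ↔
      (∀ p, toShelfHom f (toShelfHom fst p) = toShelfHom g (toShelfHom snd p)) ∧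
      ∀ a b, toShelfHom f a = toShelfHom g b →
        ∃! p, toShelfHom fst p = a ∧ toShelfHom snd p = b := by
  constructor
  · intro h
    refine ⟨fun p => congrArg (fun k : P ⟶ C => toShelfHom k p) h.w, fun a b hab => ?_⟩
    have w : ofElement a ≫ f = ofElement b ≫ g := hom_ext fun _ => hab
    refine ⟨toShelfHom (h.lift _ _ w) PUnit.unit,
      ⟨congrArg (fun k : point ⟶ A => toShelfHom k PUnit.unit) (h.lift_fst _ _ w),
        congrArg (fun k : point ⟶ B => toShelfHom k PUnit.unit) (h.lift_snd _ _ w)⟩, ?_⟩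
    rintro p ⟨rfl, rfl⟩
    have e : ofElement p = h.lift _ _ w :=
      h.hom_ext ((hom_ext fun _ => rfl).trans (h.lift_fst _ _ w).symm)
        ((hom_ext fun _ => rfl).trans (h.lift_snd _ _ w).symm)
    exact congrArg (fun k : point ⟶ P => toShelfHom k PUnit.unit) e
  · rintro ⟨w, h⟩
    have key (s : Limits.PullbackCone f g) (x : s.pt) :=
      h (toShelfHom s.fst x) (toShelfHom s.snd x)
        (congrArg (fun k : s.pt ⟶ C => toShelfHom k x) s.condition)
    choose l hl hu using key
    refine IsPullback.of_isLimit (Limits.PullbackCone.IsLimit.mk (hom_ext w)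
      (fun s =>
        { toFun := l s
          map_act' := fun {x y} => (hu s _ _ ⟨?_, ?_⟩).symm : (s.pt : Type u) →◃ (P : Type u) })
      (fun s => hom_ext fun x => (hl s x).1) (fun s => hom_ext fun x => (hl s x).2)
      (fun s m h₁ h₂ => hom_ext fun x => hu s x _
        ⟨congrArg (fun k : s.pt ⟶ A => toShelfHom k x) h₁,
          congrArg (fun k : s.pt ⟶ B => toShelfHom k x) h₂⟩))
    · rw [ShelfHom.map_act, ShelfHom.map_act, (hl s x).1, (hl s y).1]
    · rw [ShelfHom.map_act, ShelfHom.map_act, (hl s x).2, (hl s y).2]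

end QuandleCat

/-! ### Trivial extensions -/

/-- A surjective homomorphism is a trivial extension exactly when it is injective on each
connected component; the existence half of the pullback property is automatic. -/
theorem isTrivialExtension_iff {A B : QuandleCat.{u}} (f : A ⟶ B) :
    IsTrivialExtension connCompAdjunction.{u} QuandleCat.surjective f ↔
      Function.Surjective (QuandleCat.toShelfHom f) ∧
      ∀ x y : A, ConnComp.mk x = ConnComp.mk y →
        QuandleCat.toShelfHom f x = QuandleCat.toShelfHom f y → x = y := by
  refine and_congr_right fun hf => ?_
  replace hf : Function.Surjective (QuandleCat.toShelfHom f) := hf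
  rw [QuandleCat.isPullback_iff]
  constructor
  · rintro ⟨w, h⟩ x y hc hxy
    exact (h (ConnComp.mk y) (QuandleCat.toShelfHom f y) (w y)).unique ⟨hc, hxy⟩ ⟨rfl, rfl⟩
  · intro h
    refine ⟨fun _ => rfl, fun c b hcb => ?_⟩
    obtain ⟨a, rfl⟩ : ∃ a : A, ConnComp.mk a = c := Quotient.exists_rep c
    -- The functor `π₀` sends the component of `a` to that of `f a` definitionally.
    replace hcb : ConnComp.mk (QuandleCat.toShelfHom f a) = ConnComp.mk b := hcb
    obtain ⟨g, hg, e⟩ := ConnComp.mk_eq_mk_iff.1 hcb.symm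
    obtain ⟨k, hk, e'⟩ := LMlt.exists_lift (QuandleCat.toShelfHom f) hf hg
    refine ⟨k a, ⟨ConnComp.mk_eq_mk_iff.2 ⟨k, hk, rfl⟩, (e' a).trans e⟩, ?_⟩
    rintro a' ⟨h₁, h₂⟩
    exact h _ _ (Eq.trans h₁ (ConnComp.mk_eq_mk_iff.2 ⟨k, hk, rfl⟩).symm)
      (h₂.trans ((e' a).trans e).symm)

/-! ### The kernel pair of a congruence -/

namespace RackCongruence

section Quandle

variable {Q : Type u} [Quandle Q] (α : RackCongruence Q)

/-- The congruence `α` regarded as a subquandle of `Q × Q`. -/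
def KernelPair : Type u := {p : Q × Q // α.toSetoid p.1 p.2}

instance : Quandle α.KernelPair where
  act p q := ⟨(p.1.1 ◃ q.1.1, p.1.2 ◃ q.1.2), α.act_congr p.2 q.2⟩
  invAct p q := ⟨(p.1.1 ◃⁻¹ q.1.1, p.1.2 ◃⁻¹ q.1.2), α.invAct_congr p.2 q.2⟩
  self_distrib := Subtype.ext (Prod.ext Shelf.self_distrib Shelf.self_distrib)
  left_inv _ _ := Subtype.ext (Prod.ext (Rack.left_inv _ _) (Rack.left_inv _ _))
  right_inv _ _ := Subtype.ext (Prod.ext (Rack.right_inv _ _) (Rack.right_inv _ _))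
  fix := Subtype.ext (Prod.ext Quandle.fix Quandle.fix)

namespace KernelPair

variable {α}

/-- A pair of congruent elements as an element of the kernel pair. -/
def mk (x y : Q) (h : α.toSetoid x y) : α.KernelPair := ⟨(x, y), h⟩

variable (α)

/-- The first projection of the kernel pair. -/
def fst : α.KernelPair →◃ Q where
  toFun p := p.1.1
  map_act' := rfl

/-- The second projection of the kernel pair. -/
def snd : α.KernelPair →◃ Q where
  toFun p := p.1.2
  map_act' := rfl

variable {α}

@[simp] theorem fst_mk {x y : Q} (h : α.toSetoid x y) : fst α (mk x y h) = x := rfl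

@[simp] theorem snd_mk {x y : Q} (h : α.toSetoid x y) : snd α (mk x y h) = y := rfl

theorem rel (p : α.KernelPair) : α.toSetoid (fst α p) (snd α p) := p.2

@[ext] theorem ext {p q : α.KernelPair} (h₁ : fst α p = fst α q) (h₂ : snd α p = snd α q) :
    p = q :=
  Subtype.ext (Prod.ext h₁ h₂)

theorem fst_surjective : Function.Surjective (fst α) :=
  fun x => ⟨mk x x (α.refl _), rfl⟩

/-- The diagonal action of `LMlt(Q)` preserves the connected components of the kernel pair. -/
theorem exists_diagonal_act {g : Equiv.Perm Q} (hg : g ∈ LMlt Q) :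
    ∀ p : α.KernelPair, ∃ q : α.KernelPair, fst α q = g (fst α p) ∧ snd α q = g (snd α p) ∧
      ConnComp.mk q = ConnComp.mk p := by
  induction hg using Subgroup.closure_induction_left with
  | one => exact fun p => ⟨p, rfl, rfl, rfl⟩
  | mul_left g hg h _ ih =>
    intro p
    obtain ⟨x, rfl⟩ := hg
    obtain ⟨q, e₁, e₂, e₃⟩ := ih p
    refine ⟨mk x x (α.refl _) ◃ q, ?_, ?_, (ConnComp.mk_act _ _).trans e₃⟩ <;>
      simp [ShelfHom.map_act, *]
  | inv_mul_cancel g hg h _ ih =>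
    intro p
    obtain ⟨x, rfl⟩ := hg
    obtain ⟨q, e₁, e₂, e₃⟩ := ih p
    refine ⟨mk x x (α.refl _) ◃⁻¹ q, ?_, ?_, (ConnComp.mk_invAct _ _).trans e₃⟩ <;>
      simp [ShelfHom.map_invAct, *]

/-- If congruent elements have equal left translations, then every left multiplication of the
kernel pair acts on both coordinates by the same left multiplication of `Q`. -/
theorem exists_eq_diagonal_act
    (hα : ∀ x y : Q, α.toSetoid x y → Rack.act' x = Rack.act' y)
    {g : Equiv.Perm α.KernelPair} (hg : g ∈ LMlt α.KernelPair) :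
    ∃ h ∈ LMlt Q, ∀ p, fst α (g p) = h (fst α p) ∧ snd α (g p) = h (snd α p) := by
  induction hg using Subgroup.closure_induction with
  | mem g hg =>
    obtain ⟨q, rfl⟩ := hg
    refine ⟨Rack.act' (fst α q), Rack.act'_mem_LMlt _, fun p => ⟨rfl, ?_⟩⟩
    rw [hα _ _ (rel q)]
    rfl
  | one => exact ⟨1, one_mem _, fun _ => ⟨rfl, rfl⟩⟩
  | mul g₁ g₂ _ _ ih₁ ih₂ =>
    obtain ⟨h₁, m₁, e₁⟩ := ih₁
    obtain ⟨h₂, m₂, e₂⟩ := ih₂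
    exact ⟨h₁ * h₂, mul_mem m₁ m₂, fun p => by simp [e₁, e₂]⟩
  | inv g _ ih =>
    obtain ⟨h, m, e⟩ := ih
    refine ⟨h⁻¹, inv_mem m, fun p => ?_⟩
    rw [Equiv.Perm.eq_inv_iff_eq, Equiv.Perm.eq_inv_iff_eq, ← (e _).1, ← (e _).2,
      ← Equiv.Perm.mul_apply, mul_inv_cancel, Equiv.Perm.one_apply]
    exact ⟨rfl, rfl⟩

end KernelPair

/-- The elementwise form of normality of `Q → Q/α`: the first projection of the kernel pair is
injective on connected components. -/
def IsNormal : Prop :=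
  ∀ p q : α.KernelPair, ConnComp.mk p = ConnComp.mk q →
    KernelPair.fst α p = KernelPair.fst α q → p = q

end Quandle

/-! ### Terms -/

section Rack

variable {Q : Type u} [Rack Q] (α : RackCongruence Q)

/-- `α` is contained in the Cayley kernel: congruent elements have equal left
translations. -/
def LeCayleyKernel : Prop := ∀ x y : Q, α.toSetoid x y → Rack.act' x = Rack.act' y

/-- Left multiplications that fix an element fix all elements congruent to it. -/
def FixesClasses : Prop :=
  ∀ g ∈ LMlt Q, ∀ x y : Q, α.toSetoid x y → g x = x → g y = y

variable {α}

theorem realize_congr {ι : Type*} (t : leftQuasigroupLang.Term ι) {s s' : ι → Q}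
    (h : ∀ i, α.toSetoid (s i) (s' i)) : α.toSetoid (t.realize s) (t.realize s') := by
  induction t with
  | var i => exact h i
  | func f ts ih =>
    cases f with
    | act => exact α.act_congr (ih 0) (ih 1)
    | invAct => exact α.invAct_congr (ih 0) (ih 1)

/-- Every term is a left multiplication applied to its rightmost variable `i`. The left
multiplication depends on the arguments only through their left translations, hence only up to
a congruence with covering projection. -/
theorem LeCayleyKernel.exists_realize_eq (hα : α.LeCayleyKernel) {ι : Type*}
    (t : leftQuasigroupLang.Term ι) :
    ∃ (i : ι) (G : (ι → Q) → Equiv.Perm Q), (∀ s, G s ∈ LMlt Q) ∧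
      (∀ s, t.realize s = G s (s i)) ∧
      ∀ s s', (∀ j, α.toSetoid (s j) (s' j)) → G s = G s' := by
  induction t with
  | var i => exact ⟨i, fun _ => 1, fun _ => one_mem _, fun _ => rfl, fun _ _ _ => rfl⟩
  | func f ts ih =>
    cases f with
    | act =>
      obtain ⟨i, G, hG, e, c⟩ := ih 1
      refine ⟨i, fun s => Rack.act' ((ts 0).realize s) * G s,
        fun s => mul_mem (Rack.act'_mem_LMlt _) (hG s), fun s => ?_, fun s s' h => ?_⟩
      · change (ts 0).realize s ◃ (ts 1).realize s = _
        rw [e]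
        rfl
      · change _ * _ = _ * _
        rw [c s s' h, hα _ _ (realize_congr (ts 0) h)]
    | invAct =>
      obtain ⟨i, G, hG, e, c⟩ := ih 1
      refine ⟨i, fun s => (Rack.act' ((ts 0).realize s))⁻¹ * G s,
        fun s => mul_mem (inv_mem (Rack.act'_mem_LMlt _)) (hG s), fun s => ?_, fun s s' h => ?_⟩
      · change (ts 0).realize s ◃⁻¹ (ts 1).realize s = _
        rw [e]
        rfl
      · change _ * _ = _ * _
        rw [c s s' h, hα _ _ (realize_congr (ts 0) h)]

/-- The term `s * t`. -/
def actTerm {ι : Type*} (s t : leftQuasigroupLang.Term ι) : leftQuasigroupLang.Term ι :=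
  FirstOrder.Language.Term.func (L := leftQuasigroupLang) (l := 2) LeftQuasigroupFunc.act ![s, t]

/-- The term `s \ t`. -/
def invActTerm {ι : Type*} (s t : leftQuasigroupLang.Term ι) : leftQuasigroupLang.Term ι :=
  FirstOrder.Language.Term.func (L := leftQuasigroupLang) (l := 2) LeftQuasigroupFunc.invAct
    ![s, t]

theorem realize_actTerm {ι : Type*} (s t : leftQuasigroupLang.Term ι) (v : ι → Q) :
    (actTerm s t).realize v = s.realize v ◃ t.realize v := rfl

theorem realize_invActTerm {ι : Type*} (s t : leftQuasigroupLang.Term ι) (v : ι → Q) :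
    (invActTerm s t).realize v = s.realize v ◃⁻¹ t.realize v := rfl

/-- A term representing a left multiplication `g`. Its parameters are kept as variables, so that
they can be replaced by a single element that acts trivially on the first argument. -/
theorem exists_term_of_mem_LMlt {g : Equiv.Perm Q} (hg : g ∈ LMlt Q) :
    ∃ (n : ℕ) (t : leftQuasigroupLang.Term (Fin (n + 1))) (u : Fin n → Q),
      (∀ x, t.realize (Fin.cons x u : Fin (n + 1) → Q) = g x) ∧
      ∀ x z : Q, z ◃ x = x →
        t.realize (Fin.cons x (fun _ => z) : Fin (n + 1) → Q) = x := by
  -- Each new letter of `g` is stored in a new last variable.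
  have aux (n : ℕ) (x : Q) (u : Fin n → Q) (a : Q) :
      (Fin.cons x (Fin.snoc u a) : Fin (n + 2) → Q) ∘ Fin.castSucc = Fin.cons x u := by
    rw [Fin.cons_snoc_eq_snoc_cons]
    exact Fin.snoc_comp_castSucc
  have aux_last (n : ℕ) (x : Q) (u : Fin n → Q) (a : Q) :
      (Fin.cons x (Fin.snoc u a) : Fin (n + 2) → Q) (Fin.last _) = a := by
    rw [Fin.cons_snoc_eq_snoc_cons, Fin.snoc_last]
  have aux_const (n : ℕ) (z : Q) :
      (fun _ => z : Fin (n + 1) → Q) = Fin.snoc (fun _ : Fin n => z) z := by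
    funext i
    induction i using Fin.lastCases <;> simp
  induction hg using Subgroup.closure_induction_left with
  | one => exact ⟨0, .var 0, Fin.elim0, fun _ => rfl, fun _ _ _ => rfl⟩
  | mul_left g hg h _ ih =>
    obtain ⟨a, rfl⟩ := hg
    obtain ⟨n, t, u, e₁, e₂⟩ := ih
    refine ⟨n + 1, actTerm (.var (Fin.last _)) (t.relabel Fin.castSucc), Fin.snoc u a,
      fun x => ?_, fun x z hz => ?_⟩
    · rw [realize_actTerm, FirstOrder.Language.Term.realize_relabel, aux, e₁,
        FirstOrder.Language.Term.realize_var, aux_last]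
      rfl
    · rw [aux_const, realize_actTerm, FirstOrder.Language.Term.realize_relabel, aux, e₂ x z hz,
        FirstOrder.Language.Term.realize_var, aux_last, hz]
  | inv_mul_cancel g hg h _ ih =>
    obtain ⟨a, rfl⟩ := hg
    obtain ⟨n, t, u, e₁, e₂⟩ := ih
    refine ⟨n + 1, invActTerm (.var (Fin.last _)) (t.relabel Fin.castSucc), Fin.snoc u a,
      fun x => ?_, fun x z hz => ?_⟩
    · rw [realize_invActTerm, FirstOrder.Language.Term.realize_relabel, aux, e₁,
        FirstOrder.Language.Term.realize_var, aux_last]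
      rfl
    · rw [aux_const, realize_invActTerm, FirstOrder.Language.Term.realize_relabel, aux,
        e₂ x z hz, FirstOrder.Language.Term.realize_var, aux_last, ← Rack.left_cancel z,
        Rack.act_invAct_eq, hz]

/-! ### Strong abelianness and centrality -/

/-- By the normal form of terms, all four values in the definition come from the same left
multiplication. If the rightmost variable is `x`, then `t(u, a) = t(v, b)` forces `u = v`; otherwise
`t(u, c)` and `t(v, c)` have the same rightmost argument. -/
theorem LeCayleyKernel.isStronglyAbelian (hα : α.LeCayleyKernel) :
    α.IsStronglyAbelian := by
  intro n t u v a b c huv hab hbc heq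
  replace heq : t.realize (Fin.cons u a : Fin (n + 1) → Q) = t.realize (Fin.cons v b) := heq
  change t.realize (Fin.cons u c : Fin (n + 1) → Q) = t.realize (Fin.cons v c)
  obtain ⟨i, G, hG, e, hc⟩ := hα.exists_realize_eq t
  have cons_rel {x y : Q} {r s : Fin n → Q} (hxy : α.toSetoid x y)
      (hrs : ∀ i, α.toSetoid (r i) (s i)) (j : Fin (n + 1)) :
      α.toSetoid ((Fin.cons x r : Fin (n + 1) → Q) j) ((Fin.cons y s : Fin (n + 1) → Q) j) := by
    cases j using Fin.cases with
    | zero => exact hxy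
    | succ j => exact hrs j
  have huc := hc _ _ (cons_rel (α.refl u) fun j => α.trans (hab j) (hbc j))
  have hvc := hc _ _ (cons_rel (α.refl v) hbc)
  have huv' := hc _ _ (cons_rel huv fun j => α.refl (c j))
  rw [e, e, huc, hvc, huv'] at heq
  rw [e, e, huv']
  cases i using Fin.cases with
  | zero => exact heq
  | succ i => rfl

theorem LeCayleyKernel.isCentral (hα : α.LeCayleyKernel) (h : α.FixesClasses) :
    α.IsCentral := by
  intro n t a b u v hab _ heq
  replace heq : t.realize (Fin.cons a u : Fin (n + 1) → Q) = t.realize (Fin.cons a v) := heq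
  change t.realize (Fin.cons b u : Fin (n + 1) → Q) = t.realize (Fin.cons b v)
  obtain ⟨i, G, hG, e, hc⟩ := hα.exists_realize_eq t
  have key (s : Fin n → Q) : G (Fin.cons a s) = G (Fin.cons b s) :=
    hc _ _ fun j => by
      cases j using Fin.cases with
      | zero => exact hab
      | succ j => exact α.refl (s j)
  rw [e, e, key, key] at heq
  rw [e, e]
  cases i using Fin.cases with
  | zero =>
    have := h _ (mul_mem (inv_mem (hG (Fin.cons b v))) (hG (Fin.cons b u))) a b hab
      (Equiv.Perm.inv_eq_iff_eq.2 heq)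
    exact Equiv.Perm.inv_eq_iff_eq.1 this
  | succ i => exact heq

/-- For congruent `u`, `v` and any `c`, the element `a = u \ (v * c)` is congruent to `c` and
satisfies `u * a = v * c`; strong abelianness of the term `x * y` yields `u * c = v * c`. -/
theorem IsStronglyAbelian.leCayleyKernel (h : α.IsStronglyAbelian) : α.LeCayleyKernel := by
  intro u v huv
  ext c
  have hac : α.toSetoid (u ◃⁻¹ (v ◃ c)) c := by
    have := α.invAct_congr (α.refl u) (α.act_congr (α.symm huv) (α.refl c))
    rwa [Rack.invAct_act_eq] at this
  exact h 1 (actTerm (.var 0) (.var 1)) u v (fun _ => u ◃⁻¹ (v ◃ c)) (fun _ => c) (fun _ => c)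
    huv (fun _ => hac) (fun _ => α.refl c) (Rack.act_invAct_eq u (v ◃ c))

theorem isStronglyAbelian_iff : α.IsStronglyAbelian ↔ α.LeCayleyKernel :=
  ⟨fun h => h.leCayleyKernel, fun h => h.isStronglyAbelian⟩

end Rack

section Quandle

variable {Q : Type u} [Quandle Q] {α : RackCongruence Q}

/-- If `g x = x`, compare the term of `g` at its own parameters and at the constant parameter `x`:
both values at `x` are `x`, so by centrality both values at a congruent `y` agree, and the second
one is `y` because `x * y = y * y = y`. -/
theorem IsCentral.fixesClasses (h : α.IsCentral) (hα : α.LeCayleyKernel) : α.FixesClasses := by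
  intro g hg x y hxy hgx
  obtain ⟨n, t, u, e₁, e₂⟩ := exists_term_of_mem_LMlt hg
  have hy : x ◃ y = y := by
    rw [← Rack.act'_apply, hα x y hxy, Rack.act'_apply, Quandle.fix]
  have : t.realize (Fin.cons y u : Fin (n + 1) → Q) = t.realize (Fin.cons y fun _ => x) :=
    h n t x y u (fun _ => x) hxy (fun _ => trivial)
      ((e₁ x).trans (hgx.trans (e₂ x x Quandle.fix).symm))
  rw [← e₁, this, e₂ y x hy]

theorem isNormal_iff : α.IsNormal ↔ α.LeCayleyKernel ∧ α.FixesClasses := by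
  constructor
  · intro h
    refine ⟨fun a b hab => Equiv.ext fun x => ?_, fun g hg x y hxy hgx => ?_⟩
    · -- Moving `(x, x)` by `(a, b)` and then back by `(a, a)` fixes the first coordinate.
      have := h (KernelPair.mk a a (α.refl a) ◃⁻¹ (KernelPair.mk a b hab ◃
          KernelPair.mk x x (α.refl x))) (KernelPair.mk x x (α.refl x))
        ((ConnComp.mk_invAct _ _).trans (ConnComp.mk_act _ _))
        (by simp [ShelfHom.map_invAct])
      have e := congrArg (KernelPair.snd α) this
      rw [ShelfHom.map_invAct, ShelfHom.map_act, ← Rack.left_cancel (KernelPair.snd α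
        (KernelPair.mk a a (α.refl a))), Rack.act_invAct_eq] at e
      exact e.symm
    · obtain ⟨q, e₁, e₂, hq⟩ := KernelPair.exists_diagonal_act hg (KernelPair.mk x y hxy)
      rw [h _ _ hq (e₁.trans hgx)] at e₂
      exact e₂.symm
  · rintro ⟨hα, h⟩ p q hpq hfst
    obtain ⟨g, hg, rfl⟩ := ConnComp.mk_eq_mk_iff.1 hpq
    obtain ⟨k, hk, e⟩ := KernelPair.exists_eq_diagonal_act hα hg
    refine KernelPair.ext hfst ?_
    rw [(e q).1] at hfst
    rw [(e q).2]
    exact h k hk _ _ (KernelPair.rel q) hfst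

theorem isNormal_iff_isCentral : α.IsNormal ↔ α.LeCayleyKernel ∧ α.IsCentral := by
  rw [isNormal_iff]
  exact ⟨fun h => ⟨h.1, h.1.isCentral h.2⟩, fun h => ⟨h.1, h.2.fixesClasses h.1⟩⟩

theorem isNormal_iff_isStronglyAbelian :
    α.IsNormal ↔ α.IsStronglyAbelian ∧ α.IsCentral := by
  rw [isNormal_iff_isCentral, isStronglyAbelian_iff]

theorem ker_proj (α : RackCongruence Q) : ker α.proj = α := by
  obtain ⟨s, _, _⟩ := α
  have : Setoid.ker (Quotient.mk s) = s := Setoid.ker_mk_eq s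
  simp only [ker, mk.injEq]
  exact this

theorem proj_surjective (α : RackCongruence Q) : Function.Surjective α.proj :=
  Quotient.mk_surjective

end Quandle

end RackCongruence

/-! ### Normal extensions -/

open RackCongruence

/-- The subquandle `ker f` of `Q × Q`, with its two projections, is a kernel pair of `f`. -/
theorem isKernelPair_ker {Q R : Type u} [Quandle Q] [Quandle R] (f : Q →◃ R) :
    IsKernelPair (QuandleCat.ofHom f) (QuandleCat.ofHom (KernelPair.fst (ker f)))
      (QuandleCat.ofHom (KernelPair.snd (ker f))) := by
  refine QuandleCat.isPullback_iff.2 ⟨fun p => KernelPair.rel p, fun a b hab => ?_⟩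
  refine ⟨KernelPair.mk a b hab, ⟨rfl, rfl⟩, ?_⟩
  rintro p ⟨h₁, h₂⟩
  exact KernelPair.ext h₁ h₂

theorem isNormalExtension_iff {Q R : Type u} [Quandle Q] [Quandle R] (f : Q →◃ R) :
    IsNormalExtension connCompAdjunction.{u} QuandleCat.surjective (QuandleCat.ofHom f) ↔
      Function.Surjective f ∧ (ker f).IsNormal := by
  refine and_congr_right fun _ => ⟨?_, fun h => ?_⟩
  · rintro ⟨K, p₁, p₂, hK, hp⟩ p q hpq hfst
    rw [isTrivialExtension_iff] at hp
    -- The comparison with the given kernel pair carries components to components.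
    let l := hK.lift _ _ (isKernelPair_ker f).w
    have l₁ (r : (ker f).KernelPair) : QuandleCat.toShelfHom p₁ (QuandleCat.toShelfHom l r) =
        KernelPair.fst (ker f) r :=
      congrArg (fun k : QuandleCat.mk (ker f).KernelPair ⟶ QuandleCat.mk Q =>
        QuandleCat.toShelfHom k r) (hK.lift_fst _ _ (isKernelPair_ker f).w)
    have l₂ (r : (ker f).KernelPair) : QuandleCat.toShelfHom p₂ (QuandleCat.toShelfHom l r) =
        KernelPair.snd (ker f) r :=
      congrArg (fun k : QuandleCat.mk (ker f).KernelPair ⟶ QuandleCat.mk Q =>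
        QuandleCat.toShelfHom k r) (hK.lift_snd _ _ (isKernelPair_ker f).w)
    have e := hp.2 _ _ (ConnComp.mk_map_eq (QuandleCat.toShelfHom l) hpq)
      ((l₁ p).trans (hfst.trans (l₁ q).symm))
    refine KernelPair.ext hfst ?_
    rw [← l₂ p, ← l₂ q, e]
  · exact ⟨_, _, _, isKernelPair_ker f,
      (isTrivialExtension_iff _).2 ⟨KernelPair.fst_surjective, h⟩⟩

theorem mainTheorem6 :
    (∀ (Q : Type u) [Quandle Q] (α : RackCongruence Q),
      IsNormalExtension connCompAdjunction.{u} QuandleCat.surjective (QuandleCat.ofHom α.proj) ↔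
        α.IsStronglyAbelian ∧ α.IsCentral) ∧
    (∀ (Q R : Type u) [Quandle Q] [Quandle R] (f : Q →◃ R),
      IsNormalExtension connCompAdjunction.{u} QuandleCat.surjective (QuandleCat.ofHom f) ↔
        IsCentralCovering f) := by
  refine ⟨fun Q _ α => ?_, fun Q R _ _ f => ?_⟩
  · rw [isNormalExtension_iff, ker_proj, isNormal_iff_isStronglyAbelian]
    exact and_iff_right α.proj_surjective
  · rw [isNormalExtension_iff, isNormal_iff_isCentral, ← and_assoc]
    rfl
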